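/- Write $M_d=\mathbb C^{d\times d}$. A channel $\mathcal M:M_{d_{\mathrm{in}}}\to M_{d_{\mathrm{out}}}$ is a completely positive, trace-preserving linear map. For a linear map $\mathcal L:M_{d_{\mathrm{in}}}\to M_{d_{\mathrm{out}}}$ let $\|\mathcal L\|_{\mathrm{ACID}}=\|(\mathcal L\otimes\mathcal I_{d_{\mathrm{in}}})(\Phi_{d_{\mathrm{in}}})\|_1$, where $\Phi_d=\frac1d\sum_{i,j=1}^d|ii\rangle\langle jj|$ and $\|\cdot\|_1$ is the trace norm (the sum of the singular values). A deterministic ancilla-free, non-adaptive tester making $n$ queries consists of pure states $\psi_1,\dots,\psi_n\in M_{d_{\mathrm{in}}}$, POVMs $P^{(1)},\dots,P^{(n)}$ on $\mathbb C^{d_{\mathrm{out}}}$ with finitely many outcomes, where $P^{(j)}=(P^{(j)}_1,\dots,P^{(j)}_{m_j})$, and a function $f:[m_1]\times\cdots\times[m_n]\to\{\mathrm{Accept},\mathrm{Reject}\}$. Given $\mathcal M$, it measures $P^{(j)}$ on $\mathcal M(\psi_j)$ independently for each $j$ and outputs $f$ of the outcomes, so it accepts with probability $\sum_{x:\,f(x)=\mathrm{Accept}}\prod_{j=1}^n\mathrm{tr}\big(P^{(j)}_{x_j}\mathcal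 M(\psi_j)\big)$. An ancilla-free, non-adaptive tester making $n$ queries is a (finite) convex combination of such deterministic testers, its acceptance probability being the corresponding average. **Theorem 1.9.** There is a universal constant $C>0$ such that the following holds. Let $\mathcal N:M_{d_{\mathrm{in}}}\to M_{d_{\mathrm{out}}}$ be any of the following types of channels: - an erasure channel, i.e. $d_{\mathrm{out}}$ divides $d_{\mathrm{in}}$ and, under an identification of the standard basis of $\mathbb C^{d_{\mathrm{in}}}$ with the product basis of $\mathbb C^{d_{\mathrm{out}}}\otimes\mathbb C^{d_{\mathrm{in}}/d_{\mathrm{out}}}$, $\mathcal N(X\otimes Y)=\mathrm{tr}(Y)\,X$ for all $X\in M_{d_{\mathrm{out}}}$ and $Y\in M_{d_{\mathrm{in}}/d_{\mathrm{out}}}$; - a unitary channel, i.e. $d_{\mathrm{in}}=d_{\mathrm{out}}$ and $\mathcal N(X)=UXU^\dagger$ for all $X$, for some unitary $U$; - a pure-state replacement channel, i.e. $\mathcal N(X)=\mathrm{tr}(X)\,\psi$ for all $X$, for some pure state $\psi\in M_{d_{\mathrm{out}}}$. Then for every $\varepsilon>0$ there is an ancilla-free, non-adaptive tester making at most $C/\varepsilon^2$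 queries to a channel $\mathcal M:M_{d_{\mathrm{in}}}\to M_{d_{\mathrm{out}}}$ that accepts with probability $1$ if $\mathcal M=\mathcal N$, and accepts with probability at most $1/2$ if $\|\mathcal M-\mathcal N\|_{\mathrm{ACID}}\ge\varepsilon$. -/

import Mathlib

open scoped Matrix Kronecker ComplexOrder

namespace ChannelTesting

/-- A superoperator: a linear map from `a × a` complex matrices to `b × b` complex matrices. -/
abbrev SuperOp (a b : ℕ) : Type :=
  Matrix (Fin a) (Fin a) ℂ →ₗ[ℂ] Matrix (Fin b) (Fin b) ℂ

/-- `L ⊗ id_k` applied to a matrix on `ℂ^a ⊗ ℂ^k`: the map `L` acts on every block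
obtained by fixing the indices `s, t` of the second tensor factor. -/
def tensorId {a b : ℕ} (L : SuperOp a b) (k : ℕ)
    (X : Matrix (Fin a × Fin k) (Fin a × Fin k) ℂ) :
    Matrix (Fin b × Fin k) (Fin b × Fin k) ℂ :=
  Matrix.of fun p q => L (Matrix.of fun i j => X (i, p.2) (j, q.2)) p.1 q.1

/-- Completely positive: every `L ⊗ id_k` maps positive semidefinite matrices to
positive semidefinite matrices. -/
def IsCompletelyPositive {a b : ℕ} (L : SuperOp a b) : Prop :=
  ∀ (k : ℕ) (X : Matrix (Fin a × Fin k) (Fin a × Fin k) ℂ),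
    X.PosSemidef → (tensorId L k X).PosSemidef

/-- A quantum channel: a completely positive, trace-preserving superoperator. -/
def IsChannel {a b : ℕ} (L : SuperOp a b) : Prop :=
  IsCompletelyPositive L ∧ ∀ X, (L X).trace = X.trace

/-- The (density matrix of the) maximally entangled state
`Φ_d = (1/d) ∑ i j, |i i⟩⟨j j|` on `ℂ^d ⊗ ℂ^d`. -/
noncomputable def maxEntangled (d : ℕ) : Matrix (Fin d × Fin d) (Fin d × Fin d) ℂ :=
  Matrix.of fun p q => if p.1 = p.2 ∧ q.1 = q.2 then (1 : ℂ) / (d : ℂ) else 0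

/-- The Choi operator `J(L) = (L ⊗ id) Φ`. -/
noncomputable def choi {a b : ℕ} (L : SuperOp a b) :
    Matrix (Fin b × Fin a) (Fin b × Fin a) ℂ :=
  tensorId L a (maxEntangled a)

/-- The trace norm: the sum of the singular values of `A`, that is, of the square roots of the
eigenvalues (with multiplicity) of `Aᴴ A`. -/
noncomputable def traceNorm {m n : Type*} [Fintype m] [Fintype n] [DecidableEq n]
    (A : Matrix m n ℂ) : ℝ :=
  ∑ i, Real.sqrt ((Matrix.isHermitian_conjTranspose_mul_self A).eigenvalues i)

/-- The average-case imitation diamond norm: the trace norm of the Choi operator. -/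
noncomputable def acidNorm {a b : ℕ} (L : SuperOp a b) : ℝ :=
  traceNorm (choi L)

/-- A pure state, as a density matrix: `|v⟩⟨v|` for a unit vector `v`. -/
def IsPureState {d : ℕ} (ψ : Matrix (Fin d) (Fin d) ℂ) : Prop :=
  ∃ v : Fin d → ℂ, star v ⬝ᵥ v = 1 ∧ ψ = Matrix.vecMulVec v (star v)

/-- An erasure channel `X ⊗ Y ↦ tr(Y) X`, where `ℂ^a` is identified with `ℂ^b ⊗ ℂ^(a/b)` by
a bijection `e` between the standard bases. Such a bijection exists only if `b` divides `a`. -/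
def IsErasureChannel {a b : ℕ} (N : SuperOp a b) : Prop :=
  ∃ e : Fin a ≃ Fin b × Fin (a / b),
    ∀ (X : Matrix (Fin b) (Fin b) ℂ) (Y : Matrix (Fin (a / b)) (Fin (a / b)) ℂ),
      N ((X ⊗ₖ Y).submatrix e e) = Y.trace • X

/-- A unitary channel `X ↦ U X Uᴴ`. The two equations on `U` force `a = b`. -/
def IsUnitaryChannel {a b : ℕ} (N : SuperOp a b) : Prop :=
  ∃ U : Matrix (Fin b) (Fin a) ℂ, Uᴴ * U = 1 ∧ U * Uᴴ = 1 ∧ ∀ X, N X = U * X * Uᴴ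

/-- A pure-state replacement channel `X ↦ tr(X) ψ`. -/
def IsPureReplacementChannel {a b : ℕ} (N : SuperOp a b) : Prop :=
  ∃ ψ : Matrix (Fin b) (Fin b) ℂ, IsPureState ψ ∧ ∀ X, N X = X.trace • ψ

/-- A positive operator-valued measure with `m` outcomes on `ℂ^d`. -/
structure POVM (d m : ℕ) where
  effect : Fin m → Matrix (Fin d) (Fin d) ℂ
  posSemidef : ∀ i, (effect i).PosSemidef
  sum_eq_one : ∑ i, effect i = 1

/-- The probability `tr(P_i ρ)` of outcome `i` when `P` is performed on the state `ρ`. -/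
noncomputable def POVM.prob {d m : ℕ} (P : POVM d m) (ρ : Matrix (Fin d) (Fin d) ℂ)
    (i : Fin m) : ℝ :=
  (P.effect i * ρ).trace.re

/-- A deterministic ancilla-free, non-adaptive channel tester making `n` queries to a channel
from `a × a` to `b × b` matrices: the `j`-th query applies the channel to a fixed pure state and
measures the output with a fixed POVM; the verdict is a function of all `n` outcomes. -/
structure DetTester (a b n : ℕ) where
  input : Fin n → Matrix (Fin a) (Fin a) ℂ
  input_pure : ∀ j, IsPureState (input j)
  outcomes : Fin n → ℕ
  povm : ∀ j, POVM b (outcomes j)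
  accept : (∀ j, Fin (outcomes j)) → Bool

/-- The probability that the tester accepts when the unknown channel is `M`
(outcomes of different queries are independent). -/
noncomputable def DetTester.acceptProb {a b n : ℕ} (T : DetTester a b n) (M : SuperOp a b) : ℝ :=
  ∑ x : (∀ j, Fin (T.outcomes j)),
    if T.accept x then ∏ j, (T.povm j).prob (M (T.input j)) (x j) else 0

/-- A (randomized) ancilla-free, non-adaptive channel tester making `n` queries: a convex
combination of deterministic ones. -/
structure Tester (a b n : ℕ) where
  size : ℕ
  weight : Fin size → ℝ
  weight_nonneg : ∀ i, 0 ≤ weight i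
  weight_sum : ∑ i, weight i = 1
  det : Fin size → DetTester a b n

/-- The probability, over the choice of the deterministic tester and the measurements, that the
tester accepts when the unknown channel is `M`. -/
noncomputable def Tester.acceptProb {a b n : ℕ} (T : Tester a b n) (M : SuperOp a b) : ℝ :=
  ∑ i, T.weight i * (T.det i).acceptProb M

end ChannelTesting

/-! Write J for `choi M` and R for `choi N`, so that the ACID distance is the trace norm of J - R.
In all three cases R = c V V†, the normalized projection onto the range of an isometry V. Every
channel satisfies V†JV ≤ c, because the reduced state of J on the reference system is maximally
mixed. So J is close to R as soon as its weight outside the range of V is small: with q = 1 -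
tr(V†JV), a gentle-measurement argument (`traceNorm_sub_le`, optimized over s) gives ‖J - R‖₁ ≤ 2√q
+ q. Distance at least ε therefore forces q ≥ ε²/10 (`bounds_of_le_traceNorm_sub`).

It remains to detect q with one query and no ancilla. For a replacement channel, sending a uniform
basis state and testing the output for ψ fails with mean probability exactly q. Unitary and erasure
channels have the form X ↦ ∑ W_y X W_y†, with coisometries W_y whose initial spaces are orthogonal.
Here y is uniform, v is a random basis or phase vector, W_y† v is sent and the output is tested for
v. The moments of v express the mean passing probability through the entanglement fidelity of X ↦
M(W_y† X W_y), whose mean over y is 1 - q, and the test fails with mean probability at least q/2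
(`sum_testWeight_mul_passProb_le`).

The channel N passes each such test with certainty, so accepting only when O(1/ε²) independent tests
all pass has one-sided error (`exists_tester_of_family`). -/

namespace ChannelTesting

open Matrix

/-! ### Trace norm and the gentle-measurement bound -/

section TraceNorm

variable {ι κ : Type*} [Fintype ι] [Fintype κ]

lemma trace_mul_mul_nonneg {J : Matrix ι ι ℂ} (hJ : J.PosSemidef) (A : Matrix κ ι ℂ) :
    0 ≤ (A * J * Aᴴ).trace.re :=
  (Complex.nonneg_iff.mp (hJ.mul_mul_conjTranspose_same A).trace_nonneg).1

lemma re_trace_conjTranspose (A : Matrix ι ι ℂ) : Aᴴ.trace.re = A.trace.re := by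
  rw [trace_conjTranspose]; exact Complex.conj_re _

variable [DecidableEq ι]

/-- The trace norm of a Hermitian matrix is attained on its sign, a Hermitian unitary. -/
lemma exists_sign_traceNorm_eq {H : Matrix ι ι ℂ} (hH : H.IsHermitian) :
    ∃ S : Matrix ι ι ℂ, S.IsHermitian ∧ S * S = 1 ∧ traceNorm H = (H * S).trace.re := by
  set U : Matrix ι ι ℂ := hH.eigenvectorUnitary.1 with hU
  have hU1 : U * Uᴴ = 1 := Unitary.coe_mul_star_self hH.eigenvectorUnitary
  have hU2 : Uᴴ * U = 1 := Unitary.coe_star_mul_self hH.eigenvectorUnitary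
  set d := hH.eigenvalues with hd
  have hspec : H = U * diagonal (fun i => (d i : ℂ)) * Uᴴ := by
    conv_lhs => rw [hH.spectral_theorem, Unitary.conjStarAlgAut_apply]
    rfl
  have conj_mul (A B : Matrix ι ι ℂ) : U * A * Uᴴ * (U * B * Uᴴ) = U * (A * B) * Uᴴ := by
    rw [show U * A * Uᴴ * (U * B * Uᴴ) = U * A * (Uᴴ * U) * B * Uᴴ by simp only [Matrix.mul_assoc],
      hU2]
    simp only [Matrix.mul_assoc, Matrix.one_mul]
  have conj_trace (A : Matrix ι ι ℂ) : (U * A * Uᴴ).trace = A.trace := by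
    rw [Matrix.trace_mul_cycle, hU2, Matrix.one_mul]
  -- Zero eigenvalues get sign 1, so that the sign squares to the identity even when H is singular.
  let s : ι → ℝ := fun i => if 0 ≤ d i then 1 else -1
  have hs : ∀ i, s i * s i = 1 := fun i => by simp only [s]; split_ifs <;> norm_num
  have hds : ∀ i, d i * s i = |d i| := fun i => by
    simp only [s]; split_ifs with h
    · rw [abs_of_nonneg h, mul_one]
    · rw [abs_of_neg (not_le.mp h)]; ring
  refine ⟨U * diagonal (fun i => (s i : ℂ)) * Uᴴ, ?_, ?_, ?_⟩
  · apply isHermitian_mul_mul_conjTranspose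
    rw [Matrix.isHermitian_diagonal_iff]
    intro i
    exact Complex.conj_ofReal _
  · rw [conj_mul, diagonal_mul_diagonal]
    simp_rw [← Complex.ofReal_mul, hs]
    simp [hU1]
  · have hsum : (H * (U * diagonal (fun i => (s i : ℂ)) * Uᴴ)).trace.re = ∑ i, |d i| := by
      conv_lhs => rw [hspec]
      rw [conj_mul, diagonal_mul_diagonal, conj_trace, trace_diagonal]
      simp_rw [← Complex.ofReal_mul, hds]
      simp
    rw [hsum]
    have hHH : Hᴴ * H = U * diagonal (fun i => ((d i ^ 2 : ℝ) : ℂ)) * Uᴴ := by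
      rw [hH.eq]
      conv_lhs => rw [hspec]
      rw [conj_mul, diagonal_mul_diagonal]
      simp [pow_two]
    -- The chosen enumeration of the eigenvalues of `Hᴴ * H` is unrelated to that of H. The two are
    -- compared as multisets of roots of the characteristic polynomial.
    have hchar : (Hᴴ * H).charpoly.roots
        = Multiset.map (fun i => ((d i ^ 2 : ℝ) : ℂ)) Finset.univ.val := by
      rw [hHH, charpoly_mul_comm, ← Matrix.mul_assoc, hU2, Matrix.one_mul, charpoly_diagonal,
        Polynomial.roots_prod _ _ (Finset.prod_ne_zero_iff.mpr fun i _ =>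
          Polynomial.X_sub_C_ne_zero _)]
      simp only [Polynomial.roots_X_sub_C, Multiset.bind_singleton]
    have hroots := (isHermitian_conjTranspose_mul_self H).roots_charpoly_eq_eigenvalues
    rw [hchar] at hroots
    have := congrArg (fun m : Multiset ℂ => (m.map fun z => Real.sqrt z.re).sum) hroots
    simp only [Multiset.map_map, Function.comp_def] at this
    rw [traceNorm]
    refine Eq.trans ?_ (this.symm.trans ?_)
    · rfl
    · simp only [Complex.ofReal_re, Real.sqrt_sq_eq_abs]
      rfl

variable [DecidableEq κ]

/-- A gentle-measurement bound: `J` is a state that is close to the range of the isometry `V`, on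
which it is dominated by `R`, the normalized projection onto that range. -/
lemma traceNorm_sub_le {J R : Matrix ι ι ℂ} {V : Matrix ι κ ℂ} {c : ℝ}
    (hJ : J.PosSemidef) (hJ1 : J.trace = 1) (hV : Vᴴ * V = 1)
    (hc : c * Fintype.card κ = 1) (hR : R = (c : ℂ) • (V * Vᴴ))
    (hle : ((c : ℂ) • (1 : Matrix κ κ ℂ) - Vᴴ * J * V).PosSemidef) {s : ℝ} (hs : 0 < s) :
    traceNorm (J - R) ≤ (s + 1) * (1 - (Vᴴ * J * V).trace.re) + s⁻¹ := by
  have hRH : R.IsHermitian := by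
    rw [hR, IsHermitian, conjTranspose_smul, conjTranspose_mul, conjTranspose_conjTranspose]
    simp
  obtain ⟨S, hSH, hSS, hS⟩ := exists_sign_traceNorm_eq (hJ.isHermitian.sub hRH)
  rw [hS]
  set q := 1 - (Vᴴ * J * V).trace.re with hq
  set A := (c : ℂ) • (1 : Matrix κ κ ℂ) - Vᴴ * J * V with hA
  set Q := V * Vᴴ with hQ
  have hQH : Qᴴ = Q := by simp [hQ]
  have hQQ : Q * Q = Q := by
    rw [hQ, Matrix.mul_assoc, ← Matrix.mul_assoc Vᴴ, hV, Matrix.one_mul]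
  have hAtr : A.trace.re = q := by
    rw [hA, trace_sub, trace_smul, trace_one, hq, Complex.sub_re]
    congr 1
    rw [← hc]; simp
  have hVA : V * A * Vᴴ = R - Q * J * Q := by
    rw [hA, hR, hQ]
    simp only [Matrix.mul_sub, Matrix.sub_mul, Matrix.mul_smul, Matrix.smul_mul, Matrix.mul_one,
      Matrix.mul_assoc]
  have hVAtr : (V * A * Vᴴ).trace = A.trace := by
    rw [Matrix.trace_mul_cycle, hV, Matrix.one_mul]
  -- the part of `R` not covered by `Q J Q`
  have h1 : -((R - Q * J * Q) * S).trace.re ≤ q := by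
    have h := trace_mul_mul_nonneg (hle.mul_mul_conjTranspose_same V) (1 + S)
    rw [hVA, Matrix.trace_mul_comm, ← Matrix.mul_assoc] at h
    -- `(1 + S) / 2` is a projection, so positivity of R - QJQ bounds -tr((R - QJQ) S) by the trace
    -- of R - QJQ, which is q.
    have e : (1 + S)ᴴ * (1 + S) = 2 • (1 + S) := by
      rw [conjTranspose_add, conjTranspose_one, hSH.eq, Matrix.mul_add, Matrix.add_mul,
        Matrix.add_mul, hSS]
      simp only [Matrix.one_mul, Matrix.mul_one]
      abel
    rw [e, Matrix.smul_mul, Matrix.trace_smul, Matrix.add_mul, Matrix.one_mul, trace_add,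
      Matrix.trace_mul_comm S, ← hVA, hVAtr] at h
    rw [← hVA]
    simp only [nsmul_eq_mul, Nat.cast_ofNat, Complex.mul_re, Complex.re_ofNat, Complex.add_re,
      Complex.im_ofNat, zero_mul, sub_zero, hAtr] at h
    linarith
  have htrQ : (Q * J).trace.re = 1 - q := by
    rw [hq, hQ, Matrix.mul_assoc, Matrix.trace_mul_comm]; ring
  set P := 1 - Q with hP
  have hPH : Pᴴ = P := by rw [hP, conjTranspose_sub, conjTranspose_one, hQH]
  have hPP : P * P = P := by
    rw [hP, Matrix.mul_sub, Matrix.sub_mul, Matrix.sub_mul, hQQ]; simp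
  have htrP : (P * J).trace.re = q := by
    rw [hP, Matrix.sub_mul, Matrix.one_mul, trace_sub, hJ1, Complex.sub_re, htrQ]; simp
  have htrPJP : (P * J * P).trace.re = q := by
    rw [Matrix.trace_mul_comm, ← Matrix.mul_assoc, hPP, htrP]
  -- Cauchy–Schwarz for the state `J`
  have cs (B : Matrix ι ι ℂ) :
      2 * s * (B * J * P).trace.re ≤ s ^ 2 * q + (B * J * Bᴴ).trace.re := by
    have h := trace_mul_mul_nonneg hJ ((s : ℂ) • P - B)
    have e : ((s : ℂ) • P - B) * J * ((s : ℂ) • P - B)ᴴ =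
        ((s ^ 2 : ℝ) : ℂ) • (P * J * P) - (s : ℂ) • (P * J * Bᴴ) - (s : ℂ) • (B * J * P)
          + B * J * Bᴴ := by
      rw [conjTranspose_sub, conjTranspose_smul, hPH]
      simp only [Matrix.sub_mul, Matrix.mul_sub, Matrix.smul_mul, Matrix.mul_smul,
        RCLike.star_def, Complex.conj_ofReal, Complex.ofReal_pow]
      module
    have e2 : (P * J * Bᴴ).trace.re = (B * J * P).trace.re := by
      rw [← re_trace_conjTranspose, conjTranspose_mul, conjTranspose_mul, hPH,
        conjTranspose_conjTranspose, hJ.isHermitian.eq, Matrix.mul_assoc]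
    rw [e, trace_add, trace_sub, trace_sub, trace_smul, trace_smul, trace_smul] at h
    simp only [smul_eq_mul, Complex.add_re, Complex.sub_re, Complex.re_ofReal_mul, e2,
      htrPJP] at h
    linarith
  have cs1 := cs S
  have cs2 := cs (S * Q)
  have t1 : (S * J * Sᴴ).trace.re = 1 := by
    rw [hSH.eq, Matrix.trace_mul_comm, ← Matrix.mul_assoc, hSS, Matrix.one_mul, hJ1]; simp
  have t2 : (S * Q * J * (S * Q)ᴴ).trace.re = 1 - q := by
    rw [conjTranspose_mul, hQH, hSH.eq, Matrix.trace_mul_comm,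
      show Q * S * (S * Q * J) = Q * (S * S) * Q * J by simp only [Matrix.mul_assoc], hSS,
      Matrix.mul_one, hQQ, htrQ]
  have hq0 : 0 ≤ q := hAtr ▸ (Complex.nonneg_iff.mp hle.trace_nonneg).1
  -- J - R = PJ + QJP - (R - QJQ): two terms that meet the complement P, each of order √q, and a
  -- positive remainder of trace q.
  have key : ((J - R) * S).trace.re = (S * J * P).trace.re + (S * Q * J * P).trace.re
      - ((R - Q * J * Q) * S).trace.re := by
    have a1 : (J - R) * S = (P * J) * S + (Q * J * P) * S - (R - Q * J * Q) * S := by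
      rw [hP]; noncomm_ring
    have a2 : (S * J * P).trace.re = (P * J * S).trace.re := by
      rw [← re_trace_conjTranspose, conjTranspose_mul, conjTranspose_mul, hPH, hSH.eq,
        hJ.isHermitian.eq, Matrix.mul_assoc]
    rw [a1, trace_sub, trace_add, Complex.sub_re, Complex.add_re, a2,
      Matrix.trace_mul_comm (Q * J * P) S]
    simp only [Matrix.mul_assoc]
  rw [key]
  have hss : s * s⁻¹ = 1 := mul_inv_cancel₀ hs.ne'
  -- The two Cauchy–Schwarz bounds add up to 2s²q + 2 - q, where -q is dropped.
  have : (S * J * P).trace.re + (S * Q * J * P).trace.re ≤ s * q + s⁻¹ := by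
    refine le_of_mul_le_mul_left ?_ (mul_pos two_pos hs)
    nlinarith
  linarith

lemma bounds_of_le_traceNorm_sub {J R : Matrix ι ι ℂ} {V : Matrix ι κ ℂ} {c ε : ℝ}
    (hJ : J.PosSemidef) (hJ1 : J.trace = 1) (hV : Vᴴ * V = 1)
    (hc : c * Fintype.card κ = 1) (hR : R = (c : ℂ) • (V * Vᴴ))
    (hle : ((c : ℂ) • (1 : Matrix κ κ ℂ) - Vᴴ * J * V).PosSemidef) (hε : 0 < ε)
    (h : ε ≤ traceNorm (J - R)) :
    ε ≤ 3 ∧ ε ^ 2 ≤ 10 * (1 - (Vᴴ * J * V).trace.re) := by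
  have hb := fun s : ℝ => fun hs : 0 < s => h.trans (traceNorm_sub_le hJ hJ1 hV hc hR hle hs)
  have hq1 : 0 ≤ (Vᴴ * J * V).trace.re := by
    simpa using trace_mul_mul_nonneg hJ Vᴴ
  set q := 1 - (Vᴴ * J * V).trace.re with hq
  -- At s = 1 the bound is 2q + 1, and q ≤ 1.
  have h3 : ε ≤ 3 := by
    have := hb 1 one_pos
    norm_num at this
    linarith
  refine ⟨h3, ?_⟩
  -- This choice turns `s⁻¹` into ε/2, which the left side absorbs: ε²/2 ≤ (2 + ε) q ≤ 5q.
  have h2 := hb (2 / ε) (by positivity)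
  rw [inv_div] at h2
  have : ε * (ε / 2) ≤ ε * ((2 / ε + 1) * q) := mul_le_mul_of_nonneg_left (by linarith) hε.le
  have e : ε * ((2 / ε + 1) * q) = (2 + ε) * q := by field_simp
  rw [e] at this
  have hq0 : 0 ≤ q := by
    have : 0 ≤ (2 + ε) * q := le_trans (by positivity) this
    exact nonneg_of_mul_nonneg_right this (by positivity)
  nlinarith

end TraceNorm

/-! ### Product testers and amplification by repetition -/

section Testers

/-- The projective measurement `{|o⟩⟨o|, 1 - |o⟩⟨o|}`. -/
noncomputable def POVM.ofUnitVector {d : ℕ} (o : Fin d → ℂ) (ho : star o ⬝ᵥ o = 1) : POVM d 2 where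
  effect := ![vecMulVec o (star o), 1 - vecMulVec o (star o)]
  posSemidef := by
    have hP : (vecMulVec o (star o)).PosSemidef := posSemidef_vecMulVec_self_star o
    have hPP : vecMulVec o (star o) * vecMulVec o (star o) = vecMulVec o (star o) := by
      rw [vecMulVec_mul_vecMulVec, ho, one_smul]
    have h1 : (1 - vecMulVec o (star o)).PosSemidef := by
      have h := posSemidef_conjTranspose_mul_self (1 - vecMulVec o (star o))
      rwa [conjTranspose_sub, conjTranspose_one, hP.isHermitian.eq, Matrix.mul_sub, Matrix.sub_mul,
        Matrix.sub_mul, hPP, Matrix.mul_one, Matrix.mul_one, Matrix.one_mul, sub_self,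
        sub_zero] at h
    intro i
    fin_cases i
    · exact hP
    · exact h1
  sum_eq_one := by simp [Fin.sum_univ_two]

/-- The probability that `M` maps the pure state `u` to a state passing the test `|o⟩⟨o|`. -/
noncomputable def passProb {a b : ℕ} (M : SuperOp a b) (u : Fin a → ℂ) (o : Fin b → ℂ) : ℝ :=
  (vecMulVec o (star o) * M (vecMulVec u (star u))).trace.re

/-- The deterministic tester with inputs `u j`, accepting when every output passes the test
`|o j⟩⟨o j|`. -/
noncomputable def DetTester.ofVectors {a b n : ℕ} (u : Fin n → Fin a → ℂ) (o : Fin n → Fin b → ℂ)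
    (hu : ∀ j, star (u j) ⬝ᵥ u j = 1) (ho : ∀ j, star (o j) ⬝ᵥ o j = 1) : DetTester a b n where
  input j := vecMulVec (u j) (star (u j))
  input_pure j := ⟨u j, hu j, rfl⟩
  outcomes _ := 2
  povm j := POVM.ofUnitVector (o j) (ho j)
  accept x := decide (∀ j, x j = 0)

lemma DetTester.acceptProb_ofVectors {a b n : ℕ} (u : Fin n → Fin a → ℂ) (o : Fin n → Fin b → ℂ)
    (hu : ∀ j, star (u j) ⬝ᵥ u j = 1) (ho : ∀ j, star (o j) ⬝ᵥ o j = 1) (M : SuperOp a b) :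
    (DetTester.ofVectors u o hu ho).acceptProb M = ∏ j, passProb M (u j) (o j) := by
  change ∑ x : Fin n → Fin 2, (if decide (∀ j, x j = 0) = true then
    ∏ j, (POVM.ofUnitVector (o j) (ho j)).prob (M (vecMulVec (u j) (star (u j)))) (x j) else 0) = _
  rw [Finset.sum_eq_single (fun _ => 0)]
  · simp [POVM.prob, POVM.ofUnitVector, passProb]
  · intro x _ hx
    rw [if_neg]
    simp only [decide_eq_true_eq]
    exact fun h => hx (funext h)
  · simp

/-- Drawing the pairs (input, test) independently from a distribution `w`, the `n`-query tester
accepts with the `n`-th power of the mean passing probability. -/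
lemma exists_tester_acceptProb_eq_pow {a b : ℕ} {T : Type*} [Fintype T] (w : T → ℝ)
    (u : T → Fin a → ℂ) (o : T → Fin b → ℂ) (hw : ∀ t, 0 ≤ w t) (hw1 : ∑ t, w t = 1)
    (hu : ∀ t, star (u t) ⬝ᵥ u t = 1) (ho : ∀ t, star (o t) ⬝ᵥ o t = 1) (n : ℕ) :
    ∃ τ : Tester a b n, ∀ M : SuperOp a b,
      τ.acceptProb M = (∑ t, w t * passProb M (u t) (o t)) ^ n := by
  classical
  let e := Fintype.equivFin (Fin n → T)
  refine ⟨{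
    size := Fintype.card (Fin n → T)
    weight := fun i => ∏ j, w (e.symm i j)
    weight_nonneg := fun i => Finset.prod_nonneg fun j _ => hw _
    weight_sum := ?_
    det := fun i => DetTester.ofVectors (fun j => u (e.symm i j)) (fun j => o (e.symm i j))
      (fun j => hu _) (fun j => ho _) }, fun M => ?_⟩
  · rw [e.symm.sum_comp (fun f : Fin n → T => ∏ j, w (f j)), ← Fintype.sum_pow, hw1, one_pow]
  · rw [Tester.acceptProb]
    simp only [DetTester.acceptProb_ofVectors, ← Finset.prod_mul_distrib]
    rw [e.symm.sum_comp (fun f : Fin n → T => ∏ j, w (f j) * passProb M (u (f j)) (o (f j))),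
      Fintype.sum_pow]

lemma one_sub_pow_le_half {x : ℝ} {n : ℕ} (hx : x ≤ 1) (hn : 1 ≤ n * x) : (1 - x) ^ n ≤ 1 / 2 := by
  calc (1 - x) ^ n ≤ Real.exp (-x) ^ n :=
        pow_le_pow_left₀ (by linarith) (Real.one_sub_le_exp_neg x) n
    _ = Real.exp (-(n * x)) := by rw [← Real.exp_nat_mul]; ring_nf
    _ ≤ Real.exp (-1) := Real.exp_le_exp.mpr (by linarith)
    _ ≤ 1 / 2 := by
        rw [Real.exp_neg, one_div]
        exact inv_anti₀ two_pos (by linarith [Real.add_one_le_exp 1])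

/-- If a single query to `M`, with random input and test, fails with probability of order `ε²`,
then `O(1/ε²)` independent queries suffice. -/
lemma exists_tester_of_family {a b : ℕ} {T : Type*} [Fintype T] (w : T → ℝ)
    (u : T → Fin a → ℂ) (o : T → Fin b → ℂ) (hw : ∀ t, 0 ≤ w t) (hw1 : ∑ t, w t = 1)
    (hu : ∀ t, star (u t) ⬝ᵥ u t = 1) (ho : ∀ t, star (o t) ⬝ᵥ o t = 1) (N : SuperOp a b)
    (hN : ∀ t, passProb N (u t) (o t) = 1) {ε : ℝ} (hε : 0 < ε)
    (hM : ∀ M : SuperOp a b, IsChannel M → ε ≤ acidNorm (M - N) →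
      0 ≤ ∑ t, w t * passProb M (u t) (o t) ∧
        ε ≤ 3 ∧ ε ^ 2 ≤ 20 * (1 - ∑ t, w t * passProb M (u t) (o t))) :
    ∃ n : ℕ, (n : ℝ) ≤ 29 / ε ^ 2 ∧ ∃ τ : Tester a b n, τ.acceptProb N = 1 ∧
      ∀ M : SuperOp a b, IsChannel M → ε ≤ acidNorm (M - N) → τ.acceptProb M ≤ 1 / 2 := by
  have hN1 (n : ℕ) : (∑ t, w t * passProb N (u t) (o t)) ^ n = 1 := by
    simp [hN, hw1]
  by_cases h3 : ε ≤ 3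
  · obtain ⟨τ, hτ⟩ := exists_tester_acceptProb_eq_pow w u o hw hw1 hu ho ⌈20 / ε ^ 2⌉₊
    refine ⟨⌈20 / ε ^ 2⌉₊, ?_, τ, (hτ N).trans (hN1 _), fun M hMc hMε => ?_⟩
    -- Rounding up costs at most one query, which ε ≤ 3 bounds by 9/ε²; hence 29 = 20 + 9.
    · have h1 : (1 : ℝ) ≤ 9 / ε ^ 2 := by
        rw [le_div_iff₀ (by positivity)]; nlinarith
      have := (Nat.ceil_lt_add_one (show 0 ≤ 20 / ε ^ 2 by positivity)).le
      calc _ ≤ 20 / ε ^ 2 + 1 := this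
        _ ≤ 20 / ε ^ 2 + 9 / ε ^ 2 := by linarith
        _ = 29 / ε ^ 2 := by ring
    · obtain ⟨h0, -, h20⟩ := hM M hMc hMε
      rw [hτ]
      set p := ∑ t, w t * passProb M (u t) (o t)
      have := one_sub_pow_le_half (x := 1 - p) (n := ⌈20 / ε ^ 2⌉₊) (by linarith) (by
        calc (1 : ℝ) = 20 / ε ^ 2 * (ε ^ 2 / 20) := by field_simp
          _ ≤ ⌈20 / ε ^ 2⌉₊ * (1 - p) :=
            mul_le_mul (Nat.le_ceil _) (by linarith) (by positivity) (by positivity))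
      simpa using this
  -- For ε > 3 the budget may allow no query at all, but then no channel is that far from N.
  · obtain ⟨τ, hτ⟩ := exists_tester_acceptProb_eq_pow w u o hw hw1 hu ho 0
    exact ⟨0, by simp; positivity, τ, (hτ N).trans (hN1 _),
      fun M hMc hMε => absurd (hM M hMc hMε).2.1 h3⟩

/-- When the input dimension vanishes, every superoperator is at distance zero from `N`. -/
lemma exists_tester_of_isEmpty {b : ℕ} (N : SuperOp 0 b) {ε : ℝ} (hε : 0 < ε) :
    ∃ n : ℕ, (n : ℝ) ≤ 29 / ε ^ 2 ∧ ∃ τ : Tester 0 b n, τ.acceptProb N = 1 ∧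
      ∀ M : SuperOp 0 b, IsChannel M → ε ≤ acidNorm (M - N) → τ.acceptProb M ≤ 1 / 2 := by
  refine ⟨0, by simp; positivity, ⟨1, fun _ => 1, by simp, by simp, fun _ =>
    ⟨finZeroElim, fun j => j.elim0, finZeroElim, fun j => j.elim0, fun _ => true⟩⟩, ?_, ?_⟩
  · simp [Tester.acceptProb, DetTester.acceptProb]
  · intro M _ h
    simp [acidNorm, traceNorm] at h
    linarith

end Testers

/-! ### Choi operators of channels -/

section Choi

variable {a b : ℕ}

lemma choi_apply (L : SuperOp a b) (p q : Fin b × Fin a) :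
    choi L p q = (1 / (a : ℂ)) * L (single p.2 q.2 1) p.1 q.1 := by
  have : (Matrix.of fun i j => maxEntangled a (i, p.2) (j, q.2)) =
      (1 / (a : ℂ)) • single p.2 q.2 (1 : ℂ) := by
    ext i j
    simp [maxEntangled, single, eq_comm]
  simp only [choi, tensorId, Matrix.of_apply, this]
  rw [map_smul, Matrix.smul_apply, smul_eq_mul]

lemma choi_sub (L K : SuperOp a b) : choi (L - K) = choi L - choi K := by
  ext p q
  simp [choi_apply, mul_sub]

lemma apply_eq_sum_choi [NeZero a] (L : SuperOp a b) (X : Matrix (Fin a) (Fin a) ℂ)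
    (y z : Fin b) : L X y z = a * ∑ i, ∑ j, X i j * choi L (y, i) (z, j) := by
  have ha : (a : ℂ) ≠ 0 := Nat.cast_ne_zero.mpr (NeZero.ne a)
  conv_lhs => rw [matrix_eq_sum_single X]
  simp only [map_sum, Matrix.sum_apply, choi_apply, Finset.mul_sum]
  refine Finset.sum_congr rfl fun i _ => Finset.sum_congr rfl fun j _ => ?_
  rw [show single i j (X i j) = X i j • single i j (1 : ℂ) by simp, map_smul, Matrix.smul_apply,
    smul_eq_mul]
  field_simp

lemma maxEntangled_posSemidef (d : ℕ) : (maxEntangled d).PosSemidef := by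
  have h := (posSemidef_vecMulVec_self_star
    (fun p : Fin d × Fin d => if p.1 = p.2 then (1 : ℂ) else 0)).smul
    (show (0 : ℂ) ≤ 1 / (d : ℂ) by positivity)
  convert h using 1
  ext p q
  simp only [maxEntangled, of_apply, Matrix.smul_apply, vecMulVec_apply, Pi.star_apply, smul_eq_mul]
  by_cases h1 : p.1 = p.2 <;> by_cases h2 : q.1 = q.2 <;> simp [h1, h2]

lemma IsChannel.choi_posSemidef {M : SuperOp a b} (hM : IsChannel M) : (choi M).PosSemidef :=
  hM.1 a _ (maxEntangled_posSemidef a)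

/-- The reduced state of the Choi operator on the reference system is maximally mixed. -/
lemma IsChannel.sum_choi {M : SuperOp a b} (hM : IsChannel M) (i j : Fin a) :
    ∑ x, choi M (x, i) (x, j) = if i = j then 1 / (a : ℂ) else 0 := by
  have h := hM.2 (single i j 1)
  simp only [choi_apply, ← Finset.mul_sum]
  rw [show ∑ x, M (single i j 1) x x = (M (single i j 1)).trace from rfl, h]
  by_cases hij : i = j
  · subst hij; simp
  · simp [hij, trace_single_eq_of_ne]

lemma IsChannel.choi_trace [NeZero a] {M : SuperOp a b} (hM : IsChannel M) :
    (choi M).trace = 1 := by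
  have ha : (a : ℂ) ≠ 0 := Nat.cast_ne_zero.mpr (NeZero.ne a)
  rw [Matrix.trace, Fintype.sum_prod_type_right]
  simp [hM.sum_choi, ha]

lemma IsChannel.posSemidef_apply [NeZero a] {M : SuperOp a b} (hM : IsChannel M)
    (u : Fin a → ℂ) : (M (vecMulVec u (star u))).PosSemidef := by
  -- B inserts the conjugate of u in the reference factor, so that M(uu†) = a B†JB inherits
  -- positivity from the Choi operator.
  let B : Matrix (Fin b × Fin a) (Fin b) ℂ := of fun p y => if p.1 = y then star (u p.2) else 0
  have h := (hM.choi_posSemidef.conjTranspose_mul_mul_same B).smul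
    (show (0 : ℂ) ≤ (a : ℂ) by positivity)
  convert h using 1
  ext y z
  rw [apply_eq_sum_choi]
  simp only [Matrix.smul_apply, smul_eq_mul, Matrix.mul_apply, conjTranspose_apply, B, of_apply,
    Fintype.sum_prod_type, Finset.sum_mul, vecMulVec_apply, Pi.star_apply]
  congr 1
  simp only [apply_ite star, star_star, star_zero, ite_mul, zero_mul, mul_ite, mul_zero]
  rw [Finset.sum_eq_single z (fun x _ hx => by simp [hx]) (by simp)]
  simp only [if_true]
  rw [Finset.sum_comm]
  refine Finset.sum_congr rfl fun j _ => ?_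
  rw [Finset.sum_eq_single y (fun x _ hx => by simp [hx]) (by simp)]
  simp only [if_true]
  exact Finset.sum_congr rfl fun i _ => by ring

lemma passProb_eq (M : SuperOp a b) (u : Fin a → ℂ) (o : Fin b → ℂ) :
    passProb M u o = (star o ⬝ᵥ M (vecMulVec u (star u)) *ᵥ o).re := by
  rw [passProb, vecMulVec_mul, trace_vecMulVec, dotProduct_comm, dotProduct_mulVec]

lemma passProb_nonneg [NeZero a] {M : SuperOp a b} (hM : IsChannel M) (u : Fin a → ℂ)
    (o : Fin b → ℂ) : 0 ≤ passProb M u o := by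
  rw [passProb_eq]
  exact (hM.posSemidef_apply u).re_dotProduct_nonneg o

/-- The largest eigenvalue of a positive matrix is at most its trace. With P = B†B this is
Cauchy–Schwarz on each row of B. -/
lemma re_dotProduct_mulVec_le {κ : Type*} [Fintype κ] {P : Matrix κ κ ℂ} (hP : P.PosSemidef)
    (v : κ → ℂ) : (star v ⬝ᵥ P *ᵥ v).re ≤ (star v ⬝ᵥ v).re * P.trace.re := by
  classical
  obtain ⟨B, rfl⟩ : ∃ B : Matrix κ κ ℂ, P = Bᴴ * B := by
    open scoped MatrixOrder in
    exact CStarAlgebra.nonneg_iff_eq_star_mul_self.mp hP.nonneg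
  have hnorm (x : κ → ℂ) : (star x ⬝ᵥ x).re = ∑ j, ‖x j‖ ^ 2 := by
    simp only [dotProduct, Pi.star_apply, RCLike.star_def, Complex.re_sum,
      ← Complex.normSq_eq_norm_sq, ← Complex.normSq_eq_conj_mul_self, Complex.ofReal_re]
  have htr : (Bᴴ * B).trace.re = ∑ k, ∑ j, ‖B k j‖ ^ 2 := by
    rw [Finset.sum_comm, Matrix.trace, Complex.re_sum]
    refine Finset.sum_congr rfl fun j _ => ?_
    rw [← hnorm]
    rfl
  rw [← mulVec_mulVec, dotProduct_mulVec, ← star_mulVec, hnorm, hnorm, htr, Finset.mul_sum]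
  refine Finset.sum_le_sum fun k _ => ?_
  rw [mul_comm]
  calc ‖(B *ᵥ v) k‖ ^ 2 ≤ (∑ j, ‖B k j‖ * ‖v j‖) ^ 2 := by
        gcongr
        refine (norm_sum_le Finset.univ fun j => B k j * v j).trans ?_
        simp only [norm_mul, le_refl]
    _ ≤ _ := Finset.sum_mul_sq_le_sq_mul_sq _ _ _

lemma passProb_le_one [NeZero a] {M : SuperOp a b} (hM : IsChannel M) {u : Fin a → ℂ}
    {o : Fin b → ℂ} (hu : star u ⬝ᵥ u = 1) (ho : star o ⬝ᵥ o = 1) : passProb M u o ≤ 1 := by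
  have h := re_dotProduct_mulVec_le (hM.posSemidef_apply u) o
  rw [hM.2, ho, trace_vecMulVec, dotProduct_comm u, hu] at h
  simpa [passProb_eq] using h

end Choi

/-! ### Random phases and entanglement fidelity -/

section Phases

/-- The fourth roots of unity. -/
noncomputable def phase (k : Fin 4) : ℂ := Complex.I ^ (k : ℕ)

lemma phase_add_one (k : Fin 4) : phase (k + 1) = Complex.I * phase k := by
  fin_cases k <;> simp [phase, pow_succ]

lemma star_phase_mul_phase (k : Fin 4) : star (phase k) * phase k = 1 := by
  simp [phase, ← mul_pow]

/-- Fourth moments of independent uniform fourth roots of unity. -/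
lemma sum_phase {β : Type*} [Fintype β] [DecidableEq β] (j k m l : β) :
    ∑ ω : β → Fin 4, star (phase (ω j)) * phase (ω k) * (star (phase (ω m)) * phase (ω l)) =
      if (j = k ∧ m = l) ∨ (j = l ∧ k = m) then 4 ^ Fintype.card β else 0 := by
  split_ifs with h
  · have : ∀ ω : β → Fin 4,
        star (phase (ω j)) * phase (ω k) * (star (phase (ω m)) * phase (ω l)) = 1 := by
      intro ω
      rcases h with ⟨rfl, rfl⟩ | ⟨rfl, rfl⟩
      · simp only [star_phase_mul_phase, mul_one]
      · calc _ = (star (phase (ω j)) * phase (ω j)) * (star (phase (ω k)) * phase (ω k)) := by ring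
          _ = 1 := by simp only [star_phase_mul_phase, mul_one]
    rw [Finset.sum_congr rfl fun ω _ => this ω]
    simp
  · set S := ∑ ω : β → Fin 4, star (phase (ω j)) * phase (ω k) * (star (phase (ω m)) * phase (ω l))
    let c : β → β → ℂ := fun x y => if y = x then Complex.I else 1
    -- Multiplying the phase at x by i permutes the summation range, so S vanishes once the
    -- resulting factor differs from 1. The factor -1 occurs when j = m; phases ±1 would not detect
    -- that case.
    have shift (x : β) : S = star (c x j) * c x k * (star (c x m) * c x l) * S := by
      have hphase (ω : β → Fin 4) (y : β) :
          phase ((ω + Pi.single x 1 : β → Fin 4) y) = c x y * phase (ω y) := by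
        by_cases hy : y = x
        · subst hy; simp [c, phase_add_one]
        · simp [c, hy]
      rw [Finset.mul_sum]
      refine (Equiv.sum_comp (Equiv.addRight (Pi.single x 1 : β → Fin 4)) fun ω : β → Fin 4 =>
        star (phase (ω j)) * phase (ω k) * (star (phase (ω m)) * phase (ω l))).symm.trans ?_
      refine Finset.sum_congr rfl fun ω _ => ?_
      simp only [Equiv.coe_addRight, hphase, star_mul']
      ring
    have hI : (-Complex.I : ℂ) ≠ 1 := fun h => by simpa using congrArg Complex.re h
    have conclude (x : β) (hx : star (c x j) * c x k * (star (c x m) * c x l) = -Complex.I ∨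
        star (c x j) * c x k * (star (c x m) * c x l) = -1) : S = 0 := by
      have h1 : star (c x j) * c x k * (star (c x m) * c x l) ≠ 1 := by
        rcases hx with hx | hx <;> rw [hx]
        · exact hI
        · norm_num
      have h2 := shift x
      have h3 : (1 - star (c x j) * c x k * (star (c x m) * c x l)) * S = 0 := by
        linear_combination h2
      exact (mul_eq_zero.mp h3).resolve_left (sub_ne_zero.mpr h1.symm)
    by_cases hjk : j = k
    · subst hjk
      have hml : l ≠ m := fun e => h (Or.inl ⟨rfl, e.symm⟩)
      refine conclude m (Or.inl ?_)
      by_cases hjm : j = m <;> simp [c, hml, hjm]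
    · by_cases hjl : j = l
      · subst hjl
        have hkm : k ≠ m := fun e => h (Or.inr ⟨rfl, e⟩)
        refine conclude m (Or.inl ?_)
        by_cases hjm : j = m <;> simp [c, hkm, hjm]
      · refine conclude j ?_
        by_cases hjm : m = j <;> simp [c, Ne.symm hjk, Ne.symm hjl, hjm]

variable {b : ℕ}

/-- The vector with the given phases as entries, normalized. -/
noncomputable def phaseVec (ω : Fin b → Fin 4) : Fin b → ℂ :=
  fun k => ((Real.sqrt b)⁻¹ : ℝ) * phase (ω k)

lemma star_phaseVec_mul (ω : Fin b → Fin 4) (j k : Fin b) :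
    star (phaseVec ω j) * phaseVec ω k = (b : ℂ)⁻¹ * (star (phase (ω j)) * phase (ω k)) := by
  have : (((Real.sqrt b)⁻¹ : ℝ) : ℂ) * (((Real.sqrt b)⁻¹ : ℝ) : ℂ) = (b : ℂ)⁻¹ := by
    rw [← Complex.ofReal_mul, ← mul_inv, Real.mul_self_sqrt (Nat.cast_nonneg b)]
    simp
  simp only [phaseVec, star_mul', RCLike.star_def, Complex.conj_ofReal]
  rw [← this]
  ring

lemma star_phaseVec_dotProduct [NeZero b] (ω : Fin b → Fin 4) :
    star (phaseVec ω) ⬝ᵥ phaseVec ω = 1 := by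
  have hb : (b : ℂ) ≠ 0 := Nat.cast_ne_zero.mpr (NeZero.ne b)
  simp only [dotProduct, Pi.star_apply, star_phaseVec_mul, star_phase_mul_phase]
  simp [hb]

lemma dotProduct_apply_vecMulVec (E : SuperOp b b) (v : Fin b → ℂ) :
    star v ⬝ᵥ E (vecMulVec v (star v)) *ᵥ v =
      ∑ j, ∑ l, ∑ k, ∑ m, star (v j) * v k * (star (v m) * v l) * E (single k m 1) j l := by
  have : E (vecMulVec v (star v)) = ∑ k, ∑ m, (v k * star (v m)) • E (single k m 1) := by
    conv_lhs => rw [matrix_eq_sum_single (vecMulVec v (star v))]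
    simp only [map_sum]
    refine Finset.sum_congr rfl fun k _ => Finset.sum_congr rfl fun m _ => ?_
    rw [← map_smul]
    congr 1
    simp [vecMulVec_apply]
  rw [this]
  simp only [dotProduct, mulVec, Pi.star_apply, Finset.mul_sum, Matrix.sum_apply,
    Matrix.smul_apply, smul_eq_mul, Finset.sum_mul]
  refine Finset.sum_congr rfl fun j _ => Finset.sum_congr rfl fun l _ =>
    Finset.sum_congr rfl fun k _ => Finset.sum_congr rfl fun m _ => by ring

/-- The entanglement fidelity of `E`. -/
noncomputable def entFidelity (E : SuperOp b b) : ℝ :=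
  ((b : ℝ) ^ 2)⁻¹ * (∑ k, ∑ m, E (single k m 1) k m).re

lemma passProb_single (E : SuperOp b b) (k : Fin b) :
    passProb E (Pi.single k 1) (Pi.single k 1) = (E (single k k 1) k k).re := by
  have : vecMulVec (Pi.single k (1 : ℂ)) (star (Pi.single k (1 : ℂ))) = single k k 1 := by
    rw [← Pi.single_star, star_one, ← single_eq_single_vecMulVec_single]
  rw [passProb_eq, this]
  simp

/-- The mean over random phases of the probability that `E` preserves the phase vector. -/
lemma sum_passProb_phaseVec [NeZero b] (E : SuperOp b b) (hE : ∀ X, (E X).trace = X.trace) :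
    ((4 : ℝ) ^ b)⁻¹ * ∑ ω, passProb E (phaseVec ω) (phaseVec ω) =
      entFidelity E + (b : ℝ)⁻¹ -
        ((b : ℝ) ^ 2)⁻¹ * ∑ k, passProb E (Pi.single k 1) (Pi.single k 1) := by
  have hb : (b : ℝ) ≠ 0 := Nat.cast_ne_zero.mpr (NeZero.ne b)
  let g : Fin b → Fin b → Fin b → Fin b → ℂ := fun j l k m => E (single k m 1) j l
  have h1 : ∑ ω, (star (phaseVec ω) ⬝ᵥ E (vecMulVec (phaseVec ω) (star (phaseVec ω))) *ᵥ
      phaseVec ω) = ((b : ℂ) ^ 2)⁻¹ * ∑ j, ∑ l, ∑ k, ∑ m,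
        (if (j = k ∧ m = l) ∨ (j = l ∧ k = m) then (4 : ℂ) ^ b else 0) * g j l k m := by
    simp only [dotProduct_apply_vecMulVec, star_phaseVec_mul]
    rw [Finset.sum_comm, Finset.mul_sum]
    refine Finset.sum_congr rfl fun j _ => ?_
    rw [Finset.sum_comm, Finset.mul_sum]
    refine Finset.sum_congr rfl fun l _ => ?_
    rw [Finset.sum_comm, Finset.mul_sum]
    refine Finset.sum_congr rfl fun k _ => ?_
    rw [Finset.sum_comm, Finset.mul_sum]
    refine Finset.sum_congr rfl fun m _ => ?_
    have := sum_phase j k m l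
    rw [Fintype.card_fin] at this
    rw [← this, Finset.sum_mul, Finset.mul_sum]
    exact Finset.sum_congr rfl fun ω _ => by simp only [g]; ring
  have h2 : ∑ j, ∑ l, ∑ k, ∑ m,
        (if (j = k ∧ m = l) ∨ (j = l ∧ k = m) then (4 : ℂ) ^ b else 0) * g j l k m =
      4 ^ b * (∑ k, ∑ m, g k m k m + ∑ k, ∑ j, g j j k k - ∑ k, g k k k k) := by
    -- Inclusion–exclusion over the two pairings, which overlap where all four indices agree. The
    -- first pairing yields the entanglement fidelity, the second the traces of E on basis states.
    have split (j l k m : Fin b) :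
        (if (j = k ∧ m = l) ∨ (j = l ∧ k = m) then (4 : ℂ) ^ b else 0) * g j l k m =
        4 ^ b * ((if k = j then if m = l then g j l k m else 0 else 0)
          + (if j = l then if k = m then g j l k m else 0 else 0)
          - (if k = j then if m = l then if j = l then g j l k m else 0 else 0 else 0)) := by
      by_cases e1 : j = k <;> by_cases e2 : m = l <;> by_cases e3 : j = l <;>
        by_cases e4 : k = m <;> simp_all [eq_comm]
    simp only [split, ← Finset.mul_sum, Finset.sum_sub_distrib, Finset.sum_add_distrib]
    congr 1
    have a1 : ∑ j, ∑ l, ∑ k, ∑ m, (if k = j then if m = l then g j l k m else 0 else 0) =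
        ∑ k, ∑ m, g k m k m := by simp
    have a2 : ∑ j, ∑ l, ∑ k, ∑ m, (if j = l then if k = m then g j l k m else 0 else 0) =
        ∑ k, ∑ j, g j j k k := by
      rw [Finset.sum_comm (f := fun k j => g j j k k)]
      refine Finset.sum_congr rfl fun j _ => ?_
      rw [Finset.sum_eq_single j (fun l _ hl => by simp [Ne.symm hl]) (by simp)]
      simp
    have a3 : ∑ j, ∑ l, ∑ k, ∑ m,
        (if k = j then if m = l then if j = l then g j l k m else 0 else 0 else 0) =
        ∑ k, g k k k k := by simp
    rw [a1, a2, a3]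
  have h3 : ∑ k, ∑ j, g j j k k = (b : ℂ) := by
    have (k : Fin b) : ∑ j, g j j k k = 1 := by
      rw [show ∑ j, g j j k k = (E (single k k 1)).trace from rfl, hE]
      simp
    simp [this]
  have h4 : ∑ ω, passProb E (phaseVec ω) (phaseVec ω) =
      ((b : ℝ) ^ 2)⁻¹ * (4 ^ b * ((∑ k, ∑ m, g k m k m).re + b - ∑ k, (g k k k k).re)) := by
    simp only [passProb_eq, ← Complex.re_sum]
    rw [h1, h2, h3]
    have c1 : ((b : ℂ) ^ 2)⁻¹ = ((((b : ℝ) ^ 2)⁻¹ : ℝ) : ℂ) := by push_cast; rfl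
    have c2 : (4 : ℂ) ^ b = (((4 : ℝ) ^ b : ℝ) : ℂ) := by push_cast; rfl
    rw [c1, c2, Complex.re_ofReal_mul, Complex.re_ofReal_mul, Complex.sub_re, Complex.add_re,
      Complex.natCast_re]
  rw [h4, entFidelity]
  simp only [passProb_single]
  have h4' : (4 : ℝ) ^ b ≠ 0 := by positivity
  simp only [g]
  field_simp

/-- The random test vectors: a basis vector or a vector of random phases. -/
noncomputable def testVec : Fin b ⊕ (Fin b → Fin 4) → Fin b → ℂ :=
  Sum.elim (fun k => Pi.single k 1) phaseVec

/-- The distribution of the test vectors: half of the weight is spread uniformly on the basis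
vectors, the other half on the phase vectors. -/
noncomputable def testWeight : Fin b ⊕ (Fin b → Fin 4) → ℝ :=
  Sum.elim (fun _ => (2 * (b : ℝ))⁻¹) (fun _ => (2 * (4 : ℝ) ^ b)⁻¹)

lemma testWeight_nonneg (t : Fin b ⊕ (Fin b → Fin 4)) : 0 ≤ testWeight t := by
  rcases t with t | t <;> simp only [testWeight, Sum.elim_inl, Sum.elim_inr] <;> positivity

lemma sum_testWeight [NeZero b] : ∑ t : Fin b ⊕ (Fin b → Fin 4), testWeight t = 1 := by
  have hb : (b : ℝ) ≠ 0 := Nat.cast_ne_zero.mpr (NeZero.ne b)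
  simp only [testWeight, Fintype.sum_sum_type, Sum.elim_inl, Sum.elim_inr, Finset.sum_const,
    Finset.card_univ, nsmul_eq_mul, Fintype.card_fin, Fintype.card_fun, Nat.cast_pow,
    Nat.cast_ofNat]
  field_simp
  norm_num

lemma star_testVec_dotProduct [NeZero b] (t : Fin b ⊕ (Fin b → Fin 4)) :
    star (testVec t) ⬝ᵥ testVec t = 1 := by
  rcases t with t | t
  · simp [testVec]
  · exact star_phaseVec_dotProduct t

/-- The mean probability of preserving a test vector is governed by the entanglement fidelity. -/
lemma sum_testWeight_mul_passProb_le [NeZero b] (E : SuperOp b b)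
    (hE : ∀ X, (E X).trace = X.trace)
    (hE1 : ∀ k, passProb E (Pi.single k 1) (Pi.single k 1) ≤ 1) :
    ∑ t, testWeight t * passProb E (testVec t) (testVec t) ≤ (1 + entFidelity E) / 2 := by
  have hb : (1 : ℝ) ≤ b := Nat.one_le_cast.mpr (NeZero.one_le)
  have h := sum_passProb_phaseVec E hE
  have hB : ∑ k, passProb E (Pi.single k 1) (Pi.single k 1) ≤ b := by
    simpa using Finset.sum_le_sum fun k (_ : k ∈ Finset.univ) => hE1 k
  simp only [testWeight, testVec, Fintype.sum_sum_type, Sum.elim_inl, Sum.elim_inr,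
    ← Finset.mul_sum, mul_inv, mul_assoc]
  rw [h]
  set B := ∑ k, passProb E (Pi.single k 1) (Pi.single k 1)
  -- Mixing in the basis vectors makes the total coefficient of B equal to 1/b - 1/b² ≥ 0, so the
  -- worst case is B = b.
  have : (b : ℝ)⁻¹ * B + ((b : ℝ)⁻¹ - ((b : ℝ) ^ 2)⁻¹ * B) ≤ 1 := by
    have e : 1 - ((b : ℝ)⁻¹ * B + ((b : ℝ)⁻¹ - ((b : ℝ) ^ 2)⁻¹ * B)) =
        ((b : ℝ) ^ 2)⁻¹ * ((b - 1) * (b - B)) := by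
      field_simp
      ring
    have : 0 ≤ ((b : ℝ) ^ 2)⁻¹ * ((b - 1) * (b - B)) :=
      mul_nonneg (by positivity) (mul_nonneg (by linarith) (by linarith))
    linarith
  linarith

end Phases

/-! ### Upper bounds on the Choi operator -/

section ChoiBounds

variable {a b : ℕ}

/-- The vector `e_x ⊗ f`. -/
def slot (x : Fin b) (f : Fin a → ℂ) : Fin b × Fin a → ℂ := fun p => if p.1 = x then f p.2 else 0

lemma dotProduct_slot_mulVec (J : Matrix (Fin b × Fin a) (Fin b × Fin a) ℂ) (x : Fin b)
    (f : Fin a → ℂ) : star (slot x f) ⬝ᵥ J *ᵥ slot x f =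
      ∑ i, ∑ j, star (f i) * f j * J (x, i) (x, j) := by
  simp only [dotProduct, mulVec, slot, Pi.star_apply, Fintype.sum_prod_type, Finset.mul_sum]
  rw [Finset.sum_eq_single x (fun y _ hy => by simp [hy]) (by simp)]
  refine Finset.sum_congr rfl fun i _ => ?_
  rw [Finset.sum_eq_single x (fun y _ hy => by simp [hy]) (by simp)]
  exact Finset.sum_congr rfl fun j _ => by simp; ring

lemma IsChannel.sum_slot {M : SuperOp a b} (hM : IsChannel M) (f : Fin a → ℂ) :
    ∑ x, (star (slot x f) ⬝ᵥ choi M *ᵥ slot x f).re = (a : ℝ)⁻¹ * (star f ⬝ᵥ f).re := by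
  simp only [dotProduct_slot_mulVec, ← Complex.re_sum]
  have : ∑ x, ∑ i, ∑ j, star (f i) * f j * choi M (x, i) (x, j) =
      ((a : ℝ)⁻¹ : ℝ) * (star f ⬝ᵥ f) := by
    rw [Finset.sum_comm, dotProduct, Finset.mul_sum]
    refine Finset.sum_congr rfl fun i _ => ?_
    rw [Finset.sum_comm]
    simp only [← Finset.mul_sum, hM.sum_choi]
    simp
    ring
  rw [this, Complex.re_ofReal_mul]

/-- Dephasing the first tensor factor costs at most the squared norm of the weights. -/
lemma re_quadForm_le_sum_slot {J : Matrix (Fin b × Fin a) (Fin b × Fin a) ℂ} (hJ : J.PosSemidef)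
    (v : Fin b → ℂ) (F : Fin b → Fin a → ℂ) :
    (star (fun p : Fin b × Fin a => v p.1 * F p.1 p.2) ⬝ᵥ
      J *ᵥ (fun p : Fin b × Fin a => v p.1 * F p.1 p.2)).re ≤
      (star v ⬝ᵥ v).re * ∑ x, (star (slot x (F x)) ⬝ᵥ J *ᵥ slot x (F x)).re := by
  -- The columns of B are the slots, so the quadratic form is that of B†JB at v, and the trace of
  -- B†JB is the sum over the slots.
  let B : Matrix (Fin b × Fin a) (Fin b) ℂ := of fun p x => slot x (F x) p
  have h := re_dotProduct_mulVec_le (hJ.conjTranspose_mul_mul_same B) v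
  have hBv : B *ᵥ v = fun p : Fin b × Fin a => v p.1 * F p.1 p.2 := by
    ext p
    simp [B, slot, mulVec, dotProduct, mul_comm]
  have htr : (Bᴴ * J * B).trace.re = ∑ x, (star (slot x (F x)) ⬝ᵥ J *ᵥ slot x (F x)).re := by
    rw [Matrix.trace, Complex.re_sum]
    refine Finset.sum_congr rfl fun x _ => ?_
    rw [Matrix.mul_assoc]
    rfl
  rwa [htr, ← mulVec_mulVec, ← mulVec_mulVec, dotProduct_mulVec, ← star_mulVec, hBv] at h

/-- On product vectors all slots carry the same f, so their sum is the reduced state at f. This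
saves the factor b of the general bound, as replacement channels require. -/
lemma IsChannel.re_quadForm_tensor_le {M : SuperOp a b} (hM : IsChannel M) (v : Fin b → ℂ)
    (f : Fin a → ℂ) :
    (star (fun p : Fin b × Fin a => v p.1 * f p.2) ⬝ᵥ
      choi M *ᵥ (fun p : Fin b × Fin a => v p.1 * f p.2)).re ≤
      (star v ⬝ᵥ v).re * ((a : ℝ)⁻¹ * (star f ⬝ᵥ f).re) := by
  rw [← hM.sum_slot]
  exact re_quadForm_le_sum_slot hM.choi_posSemidef v fun _ => f

/-- The Choi operator of a channel is at most `b / a`. -/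
lemma IsChannel.re_quadForm_le {M : SuperOp a b} (hM : IsChannel M) (u : Fin b × Fin a → ℂ) :
    (star u ⬝ᵥ choi M *ᵥ u).re ≤ (b / a : ℝ) * (star u ⬝ᵥ u).re := by
  -- The all-ones weight has squared norm b, the source of that factor. Each slot is then bounded by
  -- the reduced state at the block `u (x, ·)`.
  have h := re_quadForm_le_sum_slot hM.choi_posSemidef (fun _ => 1) fun x i => u (x, i)
  simp only [one_mul] at h
  have h1 : (star (fun _ : Fin b => (1 : ℂ)) ⬝ᵥ fun _ => 1).re = b := by
    simp [dotProduct]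
  rw [h1] at h
  refine h.trans ?_
  rw [div_eq_mul_inv, mul_assoc]
  refine mul_le_mul_of_nonneg_left ?_ (Nat.cast_nonneg b)
  calc _ ≤ ∑ x, (a : ℝ)⁻¹ * (star (fun i => u (x, i)) ⬝ᵥ fun i => u (x, i)).re :=
        Finset.sum_le_sum fun x _ => by
          rw [← hM.sum_slot]
          exact Finset.single_le_sum
            (f := fun y => (star (slot y fun i => u (x, i)) ⬝ᵥ
              choi M *ᵥ slot y fun i => u (x, i)).re)
            (fun y _ => hM.choi_posSemidef.re_dotProduct_nonneg _) (Finset.mem_univ x)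
    _ = _ := by
        rw [← Finset.mul_sum, ← Complex.re_sum]
        simp only [dotProduct, Fintype.sum_prod_type, Pi.star_apply]

lemma posSemidef_smul_one_sub {κ : Type*} [Fintype κ] [DecidableEq κ] {A : Matrix κ κ ℂ}
    (hA : A.IsHermitian) {c : ℝ}
    (h : ∀ w : κ → ℂ, (star w ⬝ᵥ A *ᵥ w).re ≤ c * (star w ⬝ᵥ w).re) :
    ((c : ℂ) • (1 : Matrix κ κ ℂ) - A).PosSemidef := by
  have hH : ((c : ℂ) • (1 : Matrix κ κ ℂ) - A).IsHermitian := by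
    refine IsHermitian.sub ?_ hA
    rw [IsHermitian, conjTranspose_smul, conjTranspose_one]
    simp
  refine PosSemidef.of_dotProduct_mulVec_nonneg hH fun w => ?_
  refine Complex.nonneg_iff.mpr ⟨?_, (hH.im_star_dotProduct_mulVec_self w).symm⟩
  rw [sub_mulVec, smul_mulVec, one_mulVec, dotProduct_sub, dotProduct_smul, Complex.sub_re,
    smul_eq_mul, Complex.re_ofReal_mul]
  linarith [h w]

lemma dotProduct_conj_mulVec {ι κ : Type*} [Fintype ι] [Fintype κ] (J : Matrix ι ι ℂ)
    (V : Matrix ι κ ℂ) (w : κ → ℂ) :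
    star w ⬝ᵥ (Vᴴ * J * V) *ᵥ w = star (V *ᵥ w) ⬝ᵥ J *ᵥ (V *ᵥ w) := by
  rw [← mulVec_mulVec, ← mulVec_mulVec, dotProduct_mulVec, ← star_mulVec]

end ChoiBounds

/-! ### Pure-state replacement channels -/

section Replacement

variable {a b : ℕ}

lemma exists_tester_replacement [NeZero a] {N : SuperOp a b} (hN : IsPureReplacementChannel N)
    {ε : ℝ} (hε : 0 < ε) :
    ∃ n : ℕ, (n : ℝ) ≤ 29 / ε ^ 2 ∧ ∃ τ : Tester a b n, τ.acceptProb N = 1 ∧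
      ∀ M : SuperOp a b, IsChannel M → ε ≤ acidNorm (M - N) → τ.acceptProb M ≤ 1 / 2 := by
  obtain ⟨_, ⟨v, hv, rfl⟩, hN⟩ := hN
  have ha : (a : ℝ) ≠ 0 := Nat.cast_ne_zero.mpr (NeZero.ne a)
  refine exists_tester_of_family (fun _ : Fin a => (a : ℝ)⁻¹) (fun i => Pi.single i 1)
    (fun _ => v) (fun _ => by positivity) (by simp [ha]) (fun i => by simp) (fun _ => hv)
    N (fun i => ?_) hε fun M hM hMε => ?_
  · rw [passProb_eq, hN, trace_vecMulVec, smul_mulVec, vecMulVec_mulVec, hv]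
    simp [hv]
  · have hp0 := Finset.sum_nonneg fun (i : Fin a) (_ : i ∈ Finset.univ) =>
      mul_nonneg (inv_nonneg.mpr (Nat.cast_nonneg (α := ℝ) a))
        (passProb_nonneg hM (Pi.single i 1) v)
    refine ⟨hp0, ?_⟩
    -- V maps e_i to v ⊗ e_i; the Choi state of N is ψ tensored with the maximally mixed state.
    let V : Matrix (Fin b × Fin a) (Fin a) ℂ := of fun p i => if p.2 = i then v p.1 else 0
    have hV : Vᴴ * V = 1 := by
      ext i j
      simp only [Matrix.mul_apply, conjTranspose_apply, V, of_apply, Fintype.sum_prod_type_right,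
        one_apply]
      rw [Finset.sum_eq_single i (fun k _ hk => by simp [hk]) (by simp)]
      simp only [if_true]
      split_ifs with hij
      · exact hv
      · simp
    have hVw (w : Fin a → ℂ) : V *ᵥ w = fun p => v p.1 * w p.2 := by
      ext p
      simp [V, mulVec, dotProduct]
    have hR : choi N = (((a : ℝ)⁻¹ : ℝ) : ℂ) • (V * Vᴴ) := by
      ext p q
      rw [choi_apply, hN, Matrix.smul_apply, Matrix.smul_apply, Matrix.mul_apply]
      simp only [conjTranspose_apply, V, of_apply, vecMulVec_apply, Pi.star_apply, smul_eq_mul]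
      rw [Finset.sum_eq_single p.2 (fun k _ hk => by simp [Ne.symm hk]) (by simp)]
      by_cases hpq : p.2 = q.2
      · rw [← hpq]; simp
      · simp [hpq, trace_single_eq_of_ne, Ne.symm hpq]
    have hle := posSemidef_smul_one_sub
      (hM.choi_posSemidef.conjTranspose_mul_mul_same V).isHermitian (c := (a : ℝ)⁻¹) fun w => by
        rw [dotProduct_conj_mulVec, hVw]
        simpa [hv] using hM.re_quadForm_tensor_le v w
    rw [acidNorm, choi_sub] at hMε
    obtain ⟨h3, h10⟩ := bounds_of_le_traceNorm_sub hM.choi_posSemidef hM.choi_trace hV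
      (by simp [ha]) hR hle hε hMε
    refine ⟨h3, ?_⟩
    have htr : (Vᴴ * choi M * V).trace.re =
        ∑ i, (a : ℝ)⁻¹ * passProb M (Pi.single i 1) v := by
      rw [Matrix.trace, Complex.re_sum]
      refine Finset.sum_congr rfl fun i _ => ?_
      have e : vecMulVec (Pi.single i (1 : ℂ)) (star (Pi.single i (1 : ℂ))) = single i i 1 := by
        rw [← Pi.single_star, star_one, ← single_eq_single_vecMulVec_single]
      have hd := dotProduct_conj_mulVec (choi M) V (Pi.single i 1)
      rw [hVw] at hd
      rw [passProb_eq, e, ← Complex.re_ofReal_mul]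
      congr 1
      simp only [← Pi.single_star, star_one, single_one_dotProduct, mulVec_single_one,
        col_apply] at hd
      rw [diag_apply, hd]
      simp only [dotProduct, mulVec, Pi.star_apply, Fintype.sum_prod_type, choi_apply,
        Finset.mul_sum]
      refine Finset.sum_congr rfl fun x _ => ?_
      rw [Finset.sum_eq_single i (fun k _ hk => by simp [hk]) (by simp)]
      refine Finset.sum_congr rfl fun y _ => ?_
      rw [Finset.sum_eq_single i (fun k _ hk => by simp [hk]) (by simp)]
      simp
      ring
    rw [htr] at h10
    have : (0 : ℝ) ≤ 1 - ∑ i, (a : ℝ)⁻¹ * passProb M (Pi.single i 1) v := by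
      nlinarith [sq_nonneg ε]
    linarith

end Replacement

/-! ### Unitary and erasure channels -/

section Coisometries

variable {a b : ℕ} {κ : Type*} [Fintype κ] [DecidableEq κ]

lemma mul_single_mul_conjTranspose_apply (W : Matrix (Fin b) (Fin a) ℂ) (i j : Fin a) (c : ℂ)
    (x x' : Fin b) : (W * single i j c * Wᴴ) x x' = W x i * c * star (W x' j) := by
  rw [Matrix.mul_apply, Finset.sum_eq_single j]
  · simp
  · intro l _ hl
    simp [mul_single_apply_of_ne _ _ _ _ _ hl]
  · simp

/-- The superoperator `X ↦ M (Wᴴ X W)`. -/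
noncomputable def precomp (M : SuperOp a b) (W : Matrix (Fin b) (Fin a) ℂ) : SuperOp b b where
  toFun X := M (Wᴴ * X * W)
  map_add' X Y := by rw [Matrix.mul_add, Matrix.add_mul, map_add]
  map_smul' c X := by rw [Matrix.mul_smul, Matrix.smul_mul, map_smul]; rfl

lemma conj_vecMulVec (W : Matrix (Fin b) (Fin a) ℂ) (v : Fin b → ℂ) :
    vecMulVec (Wᴴ *ᵥ v) (star (Wᴴ *ᵥ v)) = Wᴴ * vecMulVec v (star v) * W := by
  rw [mul_vecMulVec, vecMulVec_mul, star_mulVec, conjTranspose_conjTranspose]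

lemma passProb_conjTranspose_mulVec (M : SuperOp a b) (W : Matrix (Fin b) (Fin a) ℂ)
    (v : Fin b → ℂ) : passProb M (Wᴴ *ᵥ v) v = passProb (precomp M W) v v := by
  rw [passProb, conj_vecMulVec]
  rfl

lemma star_conjTranspose_mulVec_dotProduct {W : Matrix (Fin b) (Fin a) ℂ} (hW : W * Wᴴ = 1)
    {v : Fin b → ℂ} (hv : star v ⬝ᵥ v = 1) : star (Wᴴ *ᵥ v) ⬝ᵥ (Wᴴ *ᵥ v) = 1 := by
  rw [star_mulVec, ← dotProduct_mulVec, conjTranspose_conjTranspose, mulVec_mulVec, hW,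
    one_mulVec, hv]

/-- This links the random test to q: the fidelity is a quadratic form of the Choi operator at the
vectorization of W, hence a multiple of a diagonal entry of V†JV. -/
lemma entFidelity_precomp [NeZero a] (M : SuperOp a b) (W : Matrix (Fin b) (Fin a) ℂ) :
    entFidelity (precomp M W) = ((b : ℝ) ^ 2)⁻¹ * (a *
      (star (fun p : Fin b × Fin a => W p.1 p.2) ⬝ᵥ
        choi M *ᵥ fun p : Fin b × Fin a => W p.1 p.2).re) := by
  rw [entFidelity]
  congr 1
  have : ((a : ℝ) : ℂ) = a := by simp
  rw [← Complex.re_ofReal_mul, this]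
  congr 1
  simp only [dotProduct, mulVec, Pi.star_apply, Fintype.sum_prod_type, Finset.mul_sum]
  refine Finset.sum_congr rfl fun k _ => ?_
  rw [Finset.sum_comm]
  refine Finset.sum_congr rfl fun m _ => ?_
  have e : precomp M W (single k m 1) = M (Wᴴ * single k m (1 : ℂ) * W) := rfl
  rw [e, apply_eq_sum_choi, Finset.mul_sum]
  refine Finset.sum_congr rfl fun i _ => ?_
  rw [Finset.mul_sum]
  refine Finset.sum_congr rfl fun j _ => ?_
  have : (Wᴴ * single k m (1 : ℂ) * W) i j = star (W k i) * W m j := by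
    rw [Matrix.mul_assoc, Matrix.mul_apply, Finset.sum_eq_single k]
    · simp
    · intro l _ hl
      simp [single_mul_apply_of_ne _ _ _ _ _ hl]
    · simp
  rw [this]
  ring

/-- Testing channels `X ↦ ∑ y, W y * X * (W y)ᴴ` for coisometries `W y` with orthogonal initial
spaces: these are the erasure channels and the unitary channels. -/
lemma exists_tester_coisometries [NeZero a] {N : SuperOp a b}
    (W : κ → Matrix (Fin b) (Fin a) ℂ)
    (hW : ∀ y z, W y * (W z)ᴴ = if y = z then 1 else 0)
    (hN : ∀ X, N X = ∑ y, W y * X * (W y)ᴴ) (hcard : b * Fintype.card κ = a)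
    {ε : ℝ} (hε : 0 < ε) :
    ∃ n : ℕ, (n : ℝ) ≤ 29 / ε ^ 2 ∧ ∃ τ : Tester a b n, τ.acceptProb N = 1 ∧
      ∀ M : SuperOp a b, IsChannel M → ε ≤ acidNorm (M - N) → τ.acceptProb M ≤ 1 / 2 := by
  have ha : (a : ℝ) ≠ 0 := Nat.cast_ne_zero.mpr (NeZero.ne a)
  have : NeZero b := ⟨fun h => NeZero.ne a (by rw [← hcard, h, zero_mul])⟩
  have hb : (b : ℝ) ≠ 0 := Nat.cast_ne_zero.mpr (NeZero.ne b)
  have hbC : (b : ℂ) ≠ 0 := Nat.cast_ne_zero.mpr (NeZero.ne b)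
  have hκ : (Fintype.card κ : ℝ) ≠ 0 := Nat.cast_ne_zero.mpr fun h =>
    NeZero.ne a (by rw [← hcard, h, mul_zero])
  have hcard' : (b : ℝ) * Fintype.card κ = a := by exact_mod_cast hcard
  have hWW (y : κ) : W y * (W y)ᴴ = 1 := by simp [hW]
  refine exists_tester_of_family
    (fun t : κ × (Fin b ⊕ (Fin b → Fin 4)) => (Fintype.card κ : ℝ)⁻¹ * testWeight t.2)
    (fun t => (W t.1)ᴴ *ᵥ testVec t.2) (fun t => testVec t.2)
    (fun t => mul_nonneg (by positivity) (testWeight_nonneg _)) ?_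
    (fun t => star_conjTranspose_mulVec_dotProduct (hWW _) (star_testVec_dotProduct _))
    (fun t => star_testVec_dotProduct _) N (fun t => ?_) hε fun M hM hMε => ?_
  · simp only [Fintype.sum_prod_type, ← Finset.mul_sum, sum_testWeight]
    simp [hκ]
  · have e : N (vecMulVec ((W t.1)ᴴ *ᵥ testVec t.2) (star ((W t.1)ᴴ *ᵥ testVec t.2))) =
        vecMulVec (testVec t.2) (star (testVec t.2)) := by
      rw [conj_vecMulVec, hN, Finset.sum_eq_single t.1]
      · rw [show W t.1 * ((W t.1)ᴴ * vecMulVec (testVec t.2) (star (testVec t.2)) * W t.1) *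
          (W t.1)ᴴ = (W t.1 * (W t.1)ᴴ) * vecMulVec (testVec t.2) (star (testVec t.2)) *
          (W t.1 * (W t.1)ᴴ) by simp only [Matrix.mul_assoc], hWW, Matrix.one_mul, Matrix.mul_one]
      -- Orthogonality of the initial spaces: the other Kraus operators annihilate the input.
      · intro y _ hy
        rw [Matrix.mul_assoc (W t.1)ᴴ, ← Matrix.mul_assoc (W y), hW, if_neg hy, Matrix.zero_mul,
          Matrix.zero_mul]
      · simp
    rw [passProb_eq, e, vecMulVec_mulVec, star_testVec_dotProduct]
    simp [star_testVec_dotProduct]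
  · refine ⟨Finset.sum_nonneg fun t _ => mul_nonneg
      (mul_nonneg (by positivity) (testWeight_nonneg _)) (passProb_nonneg hM _ _), ?_⟩
    let s : ℝ := (Real.sqrt b)⁻¹
    have hs : s * s = (b : ℝ)⁻¹ := by
      rw [← mul_inv, Real.mul_self_sqrt (Nat.cast_nonneg b)]
    have hsC : (s : ℂ) * s = (b : ℂ)⁻¹ := by
      rw [← Complex.ofReal_mul, hs]; simp
    -- The columns are the vectorized W_y, normalized by 1/√b since tr(W_y W_y†) = b.
    let V : Matrix (Fin b × Fin a) κ ℂ := of fun p y => s * W y p.1 p.2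
    have hV : Vᴴ * V = 1 := by
      ext y z
      have h1 : (Vᴴ * V) y z = (b : ℂ)⁻¹ * (W z * (W y)ᴴ).trace := by
        simp only [Matrix.mul_apply, conjTranspose_apply, V, of_apply, Fintype.sum_prod_type,
          Matrix.trace, diag_apply, Finset.mul_sum, ← hsC, star_mul', RCLike.star_def,
          Complex.conj_ofReal]
        exact Finset.sum_congr rfl fun x _ => Finset.sum_congr rfl fun i _ => by ring
      rw [h1, hW, one_apply]
      by_cases hyz : y = z
      · simp [hyz, hbC]
      · simp [hyz, Ne.symm hyz]
    have hR : choi N = ((b / a : ℝ) : ℂ) • (V * Vᴴ) := by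
      ext p q
      rw [choi_apply, hN, Matrix.smul_apply, Matrix.mul_apply, Matrix.sum_apply, smul_eq_mul,
        Finset.mul_sum, Finset.mul_sum]
      refine Finset.sum_congr rfl fun y _ => ?_
      rw [mul_single_mul_conjTranspose_apply, mul_one]
      simp only [conjTranspose_apply, V, of_apply, star_mul', RCLike.star_def,
        Complex.conj_ofReal]
      have e : (s : ℂ) * W y p.1 p.2 * (s * (starRingEnd ℂ) (W y q.1 q.2)) =
          (b : ℂ)⁻¹ * (W y p.1 p.2 * (starRingEnd ℂ) (W y q.1 q.2)) := by rw [← hsC]; ring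
      rw [e]
      push_cast
      field_simp
    -- The range of V has dimension a/b, so the general bound b/a on J is exactly the weight c of
    -- the normalized projection.
    have hle := posSemidef_smul_one_sub
      (hM.choi_posSemidef.conjTranspose_mul_mul_same V).isHermitian (c := (b / a : ℝ)) fun w => by
        rw [dotProduct_conj_mulVec]
        refine (hM.re_quadForm_le _).trans_eq ?_
        rw [star_mulVec, ← dotProduct_mulVec, mulVec_mulVec, hV, one_mulVec]
    rw [acidNorm, choi_sub] at hMε
    obtain ⟨h3, h10⟩ := bounds_of_le_traceNorm_sub hM.choi_posSemidef hM.choi_trace hV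
      (by rw [← hcard']; field_simp) hR hle hε hMε
    refine ⟨h3, ?_⟩
    have htr : (Vᴴ * choi M * V).trace.re =
        (Fintype.card κ : ℝ)⁻¹ * ∑ y, entFidelity (precomp M (W y)) := by
      rw [Matrix.trace, Complex.re_sum, Finset.mul_sum]
      refine Finset.sum_congr rfl fun y _ => ?_
      have hd : (Vᴴ * choi M * V) y y = star (Vᵀ y) ⬝ᵥ choi M *ᵥ Vᵀ y := by
        rw [Matrix.mul_assoc]; rfl
      have hVy : Vᵀ y = (s : ℂ) • fun p : Fin b × Fin a => W y p.1 p.2 := rfl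
      rw [entFidelity_precomp, diag_apply, hd, hVy, star_smul, smul_dotProduct, mulVec_smul,
        dotProduct_smul, smul_smul, RCLike.star_def, Complex.conj_ofReal, hsC, smul_eq_mul,
        show (b : ℂ)⁻¹ = (((b : ℝ)⁻¹ : ℝ) : ℂ) by simp, Complex.re_ofReal_mul, ← hcard']
      field_simp
    have hp : ∑ t : κ × (Fin b ⊕ (Fin b → Fin 4)), (Fintype.card κ : ℝ)⁻¹ * testWeight t.2 *
        passProb M ((W t.1)ᴴ *ᵥ testVec t.2) (testVec t.2) ≤
        (1 + (Vᴴ * choi M * V).trace.re) / 2 := by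
      have hy (y : κ) := sum_testWeight_mul_passProb_le (precomp M (W y))
        (fun X => by
          change (M ((W y)ᴴ * X * W y)).trace = _
          rw [hM.2, Matrix.trace_mul_comm, ← Matrix.mul_assoc, hWW, Matrix.one_mul])
        (fun k => by
          rw [← passProb_conjTranspose_mulVec]
          have hk : star (Pi.single k (1 : ℂ) : Fin b → ℂ) ⬝ᵥ Pi.single k 1 = 1 := by simp
          exact passProb_le_one hM (star_conjTranspose_mulVec_dotProduct (hWW y) hk) hk)
      simp only [Fintype.sum_prod_type, mul_assoc, ← Finset.mul_sum,
        passProb_conjTranspose_mulVec]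
      calc _ ≤ (Fintype.card κ : ℝ)⁻¹ * ∑ y, (1 + entFidelity (precomp M (W y))) / 2 := by
            gcongr with y
            exact hy y
        _ = _ := by
            rw [htr, ← Finset.sum_div, Finset.sum_add_distrib]
            simp only [Finset.sum_const, Finset.card_univ, nsmul_eq_mul, mul_one]
            field_simp
    linarith

lemma exists_tester_unitary [NeZero a] {N : SuperOp a b} (hN : IsUnitaryChannel N)
    {ε : ℝ} (hε : 0 < ε) :
    ∃ n : ℕ, (n : ℝ) ≤ 29 / ε ^ 2 ∧ ∃ τ : Tester a b n, τ.acceptProb N = 1 ∧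
      ∀ M : SuperOp a b, IsChannel M → ε ≤ acidNorm (M - N) → τ.acceptProb M ≤ 1 / 2 := by
  obtain ⟨U, hU1, hU2, hN⟩ := hN
  refine exists_tester_coisometries (κ := Unit) (fun _ => U) (by simp [hU2]) (by simp [hN]) ?_ hε
  -- Comparing the traces of UU† and U†U shows that the dimensions agree.
  have h := Matrix.trace_mul_comm U Uᴴ
  rw [hU1, hU2, trace_one, trace_one, Fintype.card_fin, Fintype.card_fin] at h
  simpa using Nat.cast_injective h

lemma exists_tester_erasure [NeZero a] {N : SuperOp a b} (hN : IsErasureChannel N)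
    {ε : ℝ} (hε : 0 < ε) :
    ∃ n : ℕ, (n : ℝ) ≤ 29 / ε ^ 2 ∧ ∃ τ : Tester a b n, τ.acceptProb N = 1 ∧
      ∀ M : SuperOp a b, IsChannel M → ε ≤ acidNorm (M - N) → τ.acceptProb M ≤ 1 / 2 := by
  obtain ⟨e, hN⟩ := hN
  -- W_y = 1 ⊗ ⟨y| are the Kraus operators of the partial trace.
  let W : Fin (a / b) → Matrix (Fin b) (Fin a) ℂ := fun y =>
    of fun x i => if i = e.symm (x, y) then 1 else 0
  refine exists_tester_coisometries W ?_ (fun X => ?_) ?_ hε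
  · intro y z
    ext x x'
    simp only [Matrix.mul_apply, conjTranspose_apply, W, of_apply]
    by_cases hyz : y = z
    · subst hyz
      by_cases hx : x = x' <;> simp [one_apply, hx, eq_comm]
    · simp [hyz, Ne.symm hyz]
  · induction X using Matrix.induction_on' with
    | h_zero => simp
    | h_add X Y hX hY =>
      simp only [map_add, hX, hY, Matrix.mul_add, Matrix.add_mul, Finset.sum_add_distrib]
    | h_std_basis i j c =>
      obtain ⟨⟨x₁, y₁⟩, rfl⟩ := e.symm.surjective i
      obtain ⟨⟨x₂, y₂⟩, rfl⟩ := e.symm.surjective j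
      have h1 : single (e.symm (x₁, y₁)) (e.symm (x₂, y₂)) c =
          (single x₁ x₂ c ⊗ₖ single y₁ y₂ (1 : ℂ)).submatrix e e := by
        rw [single_kronecker_single, mul_one]
        ext i j
        simp [single, Equiv.symm_apply_eq]
      conv_lhs => rw [h1, hN]
      ext x x'
      simp only [Matrix.sum_apply, mul_single_mul_conjTranspose_apply, W, of_apply,
        EmbeddingLike.apply_eq_iff_eq, Prod.mk.injEq, Matrix.smul_apply, smul_eq_mul]
      rw [Finset.sum_eq_single y₁ (fun y _ hy => by simp [Ne.symm hy]) (by simp)]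
      by_cases hy : y₁ = y₂
      · subst hy
        rw [trace_single_eq_same, one_mul]
        by_cases h1 : x₁ = x <;> by_cases h2 : x₂ = x' <;> simp [single, h1, h2]
      · simp [trace_single_eq_of_ne, hy, Ne.symm hy]
  · have h := Fintype.card_congr e
    simpa using h.symm

end Coisometries

end ChannelTesting

theorem theorem1p9 :
    ∃ C : ℝ, 0 < C ∧
      ∀ (din dout : ℕ) (N : ChannelTesting.SuperOp din dout),
        (ChannelTesting.IsErasureChannel N ∨ ChannelTesting.IsUnitaryChannel N ∨
          ChannelTesting.IsPureReplacementChannel N) →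
        ∀ ε : ℝ, 0 < ε →
          ∃ n : ℕ, (n : ℝ) ≤ C / ε ^ 2 ∧
            ∃ T : ChannelTesting.Tester din dout n,
              T.acceptProb N = 1 ∧
              ∀ M : ChannelTesting.SuperOp din dout, ChannelTesting.IsChannel M →
                ε ≤ ChannelTesting.acidNorm (M - N) → T.acceptProb M ≤ 1 / 2 := by
  refine ⟨29, by norm_num, fun din dout N hN ε hε => ?_⟩
  obtain rfl | hdin := Nat.eq_zero_or_pos din
  · exact ChannelTesting.exists_tester_of_isEmpty N hε
  · have : NeZero din := ⟨hdin.ne'⟩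
    rcases hN with hN | hN | hN
    · exact ChannelTesting.exists_tester_erasure hN hε
    · exact ChannelTesting.exists_tester_unitary hN hε
    · exact ChannelTesting.exists_tester_replacement hN hε
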